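/- Let $E$ and $F$ be infinite-dimensional Archimedean Riesz spaces (real vector lattices). For an Archimedean Riesz space $X$, let $\mathcal B(X)$ be the Boolean algebra of all bands of $X$, ordered by inclusion, where a band is a solid linear subspace that contains the supremum of each of its subsets having a supremum in $X$. For Boolean algebras $\mathcal A$ and $\mathcal B$, let the free product $\mathcal A\otimes\mathcal B$ be the Boolean algebra of open-and-closed subsets of the product of the Stone spaces of $\mathcal A$ and $\mathcal B$. Let $E\bar\otimes F$ be the Archimedean Riesz space tensor product of Fremlin, i.e. the Archimedean Riesz space with a Riesz bimorphism $\otimes\colon E\times F\to E\bar\otimes F$ through which every Riesz bimorphism from $E\times F$ to an Archimedean Riesz space factors by a unique Riesz homomorphism. Then the free product $\mathcal B(E)\otimes\mathcal B(F)$ is not Boolean isomorphic to the band algebra $\mathcal B(E\bar\otimes F)$. Moreover, $\mathcal B(E)\otimes\mathcal B(F)$ is not complete, whereas $\mathcal B(E\bar\otimes F)$ is complete, a Boolean algebra being complete if each of its nonempty subsets has a supremum. -/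

import Mathlib

universe u v w

/-! ### Riesz spaces -/

/-- A real vector lattice (Riesz space): a real vector space with a lattice order for which
translations are monotone and multiplication by nonnegative scalars is monotone. -/
class RieszSpace (E : Type u) [AddCommGroup E] [Lattice E] [Module ℝ E] : Prop
    extends IsOrderedAddMonoid E, PosSMulMono ℝ E

/-- An Archimedean Riesz space: `n x ≤ y` for all `n` forces `x ≤ 0`.  (Mathlib's `Archimedean`
is a different notion, which would force the order to be total.) -/
class ArchimedeanRieszSpace (E : Type u) [AddCommGroup E] [Lattice E] [Module ℝ E] : Prop
    extends RieszSpace E where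
  le_zero_of_forall_nsmul_le : ∀ x y : E, (∀ n : ℕ, n • x ≤ y) → x ≤ 0

/-- A Riesz homomorphism: a linear map that preserves finite suprema and infima. -/
structure IsRieszHom {E : Type u} {F : Type v} [AddCommGroup E] [Lattice E] [Module ℝ E]
    [AddCommGroup F] [Lattice F] [Module ℝ F] (T : E →ₗ[ℝ] F) : Prop where
  map_sup : ∀ x y : E, T (x ⊔ y) = T x ⊔ T y
  map_inf : ∀ x y : E, T (x ⊓ y) = T x ⊓ T y

/-- A Riesz bimorphism: a bilinear map `ψ` such that `ψ(x, ·)` and `ψ(·, y)` are Riesz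
homomorphisms for all `x ≥ 0` and `y ≥ 0`. -/
structure IsRieszBimorphism {E : Type u} {F : Type v} {H : Type w}
    [AddCommGroup E] [Lattice E] [Module ℝ E] [AddCommGroup F] [Lattice F] [Module ℝ F]
    [AddCommGroup H] [Lattice H] [Module ℝ H] (ψ : E →ₗ[ℝ] F →ₗ[ℝ] H) : Prop where
  left : ∀ x : E, 0 ≤ x → IsRieszHom (ψ x)
  right : ∀ y : F, 0 ≤ y → IsRieszHom (ψ.flip y)

/-! ### Bands -/

/-- A band: an ideal (solid linear subspace) that contains the supremum of each of its subsets
that has a supremum in the whole space. -/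
structure Band (E : Type u) [AddCommGroup E] [Lattice E] [Module ℝ E] extends Submodule ℝ E where
  solid : ∀ x ∈ carrier, ∀ y : E, |y| ≤ |x| → y ∈ carrier
  isLUB_mem : ∀ S : Set E, S ⊆ carrier → ∀ x : E, IsLUB S x → x ∈ carrier

namespace Band

section basic

variable {E : Type u} [AddCommGroup E] [Lattice E] [Module ℝ E]

instance : SetLike (Band E) E where
  coe A := A.carrier
  coe_injective := by
    rintro ⟨A, _, _⟩ ⟨B, _, _⟩ h
    have : A = B := SetLike.coe_injective h
    subst this
    rfl

/-- Bands are ordered by inclusion. -/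
instance : PartialOrder (Band E) := PartialOrder.ofSetLike (Band E) E

theorem mem_mk_iff (A : Submodule ℝ E) (h₁ h₂) (x : E) : x ∈ (⟨A, h₁, h₂⟩ : Band E) ↔ x ∈ A :=
  Iff.rfl

theorem le_iff (A B : Band E) : A ≤ B ↔ ∀ x ∈ A, x ∈ B := Iff.rfl

end basic

section riesz

variable {E : Type u} [AddCommGroup E] [Lattice E] [Module ℝ E] [RieszSpace E]

theorem abs_mem {A : Band E} {x : E} (hx : x ∈ A) : |x| ∈ A :=
  A.solid x hx _ (by rw [abs_abs])

theorem mem_of_abs_mem {A : Band E} {x : E} (hx : |x| ∈ A) : x ∈ A :=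
  A.solid _ hx _ (by rw [abs_abs])

theorem mem_of_le {A : Band E} {x y : E} (hx : x ∈ A) (hy : 0 ≤ y) (h : y ≤ x) : y ∈ A :=
  A.solid x hx _ (by rwa [abs_of_nonneg hy, abs_of_nonneg (hy.trans h)])

theorem inf_add_le {a b c : E} (ha : 0 ≤ a) (hb : 0 ≤ b) (hc : 0 ≤ c) :
    (a + b) ⊓ c ≤ a ⊓ c + b ⊓ c := by
  have h1 : (a + b) ⊓ c - b ⊓ c ≤ a := by
    rw [sub_le_iff_le_add, add_inf]
    exact le_inf inf_le_left (inf_le_right.trans (le_add_of_nonneg_left ha))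
  have h2 : (a + b) ⊓ c - b ⊓ c ≤ c :=
    (sub_le_self _ (le_inf hb hc)).trans inf_le_right
  exact sub_le_iff_le_add.1 (le_inf h1 h2)

theorem isLUB_empty_eq_zero {x : E} (h : IsLUB (∅ : Set E) x) : x = 0 := by
  rw [isLUB_empty_iff] at h
  apply le_antisymm (h 0)
  have := h (x + x)
  simpa using this

/-- The disjoint complement of a set is a band. -/
def disjointCompl (D : Set E) : Band E where
  carrier := {x | ∀ a ∈ D, |x| ⊓ |a| = 0}
  zero_mem' := fun a _ => by simp
  add_mem' := by
    intro x y hx hy a ha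
    apply le_antisymm _ (le_inf (abs_nonneg _) (abs_nonneg _))
    calc |x + y| ⊓ |a| ≤ (|x| + |y|) ⊓ |a| := inf_le_inf_right _ (abs_add_le x y)
      _ ≤ |x| ⊓ |a| + |y| ⊓ |a| := inf_add_le (abs_nonneg _) (abs_nonneg _) (abs_nonneg _)
      _ = 0 := by rw [hx a ha, hy a ha, add_zero]
  smul_mem' := by
    intro c x hx a ha
    obtain ⟨n, hn⟩ := exists_nat_ge |c|
    have h1 : |c • x| ≤ n • |x| := by
      have hc : c ≤ n := (le_abs_self c).trans hn
      have hc' : -c ≤ n := (neg_le_abs c).trans hn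
      have key : ∀ r : ℝ, r ≤ n → -r ≤ n → r • x ≤ n • |x| := by
        intro r hr hr'
        have e : (n : ℝ) • |x| - r • x
            = (((n : ℝ) - r) / 2) • (|x| + x) + (((n : ℝ) + r) / 2) • (|x| - x) := by
          module
        have p1 : 0 ≤ (((n : ℝ) - r) / 2) • (|x| + x) :=
          smul_nonneg (by linarith) (by rw [← neg_le_iff_add_nonneg]; exact neg_le_abs x)
        have p2 : 0 ≤ (((n : ℝ) + r) / 2) • (|x| - x) :=
          smul_nonneg (by linarith) (sub_nonneg.2 (le_abs_self x))
        rw [← Nat.cast_smul_eq_nsmul ℝ, ← sub_nonneg, e]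
        exact add_nonneg p1 p2
      refine abs_le'.2 ⟨key c hc hc', ?_⟩
      rw [← neg_smul]
      exact key (-c) hc' (by simpa using hc)
    have h2 : ∀ m : ℕ, (m • |x|) ⊓ |a| ≤ 0 := by
      intro m
      induction m with
      | zero => simp
      | succ m ih =>
        rw [succ_nsmul]
        refine (inf_add_le (nsmul_nonneg (abs_nonneg _) m) (abs_nonneg _) (abs_nonneg _)).trans ?_
        rw [hx a ha, add_zero]
        exact ih
    exact le_antisymm ((inf_le_inf_right _ h1).trans (h2 n)) (le_inf (abs_nonneg _) (abs_nonneg _))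
  solid := fun x hx y hy a ha =>
    le_antisymm ((inf_le_inf_right _ hy).trans (hx a ha).le) (le_inf (abs_nonneg _) (abs_nonneg _))
  isLUB_mem := by
    intro S hS x hx a ha
    rcases S.eq_empty_or_nonempty with rfl | ⟨s₀, hs₀⟩
    · rw [isLUB_empty_eq_zero hx]; simp
    have ha0 : (0 : E) ≤ |a| := abs_nonneg a
    have hx0 : (0 : E) ≤ x ⊔ 0 := le_sup_right
    -- the positive part
    have hpos : (x ⊔ 0) ⊓ |a| ≤ 0 := by
      set w := (x ⊔ 0) ⊓ |a| with hw
      have hw0 : 0 ≤ w := le_inf hx0 ha0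
      have hub : x ≤ (x ⊔ 0) - w := by
        apply hx.2
        intro s hs
        have hs0 : (0 : E) ≤ s ⊔ 0 := le_sup_right
        have hd : (s ⊔ 0) ⊓ w = 0 := by
          apply le_antisymm _ (le_inf hs0 hw0)
          calc (s ⊔ 0) ⊓ w ≤ |s| ⊓ |a| :=
                inf_le_inf (sup_le (le_abs_self s) (abs_nonneg s)) inf_le_right
            _ = 0 := hS hs a ha
        have hadd : (s ⊔ 0) + w = (s ⊔ 0) ⊔ w := by
          rw [← inf_add_sup (s ⊔ 0) w, hd, zero_add]
        have : (s ⊔ 0) + w ≤ x ⊔ 0 := by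
          rw [hadd]
          exact sup_le (sup_le_sup_right (hx.1 hs) 0) inf_le_left
        exact le_sup_left.trans (le_sub_iff_add_le.2 this)
      have hub0 : (0 : E) ≤ (x ⊔ 0) - w := sub_nonneg.2 inf_le_left
      have := sup_le hub hub0
      simpa using this
    -- the negative part
    have hneg : (-x ⊔ 0) ⊓ |a| ≤ 0 := by
      have h : -x ⊔ 0 ≤ |s₀| :=
        sup_le ((neg_le_neg (hx.1 hs₀)).trans (neg_le_abs s₀)) (abs_nonneg _)
      exact (inf_le_inf_right _ h).trans (hS hs₀ a ha).le
    apply le_antisymm _ (le_inf (abs_nonneg _) (abs_nonneg _))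
    have habs : |x| ≤ (x ⊔ 0) + (-x ⊔ 0) := by
      refine abs_le'.2 ⟨?_, ?_⟩
      · exact le_sup_left.trans (le_add_of_nonneg_right le_sup_right)
      · exact le_sup_left.trans (le_add_of_nonneg_left le_sup_right)
    calc |x| ⊓ |a| ≤ ((x ⊔ 0) + (-x ⊔ 0)) ⊓ |a| := inf_le_inf_right _ habs
      _ ≤ (x ⊔ 0) ⊓ |a| + (-x ⊔ 0) ⊓ |a| := inf_add_le le_sup_right le_sup_right ha0
      _ ≤ 0 := add_nonpos hpos hneg

theorem mem_disjointCompl_iff (D : Set E) (x : E) :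
    x ∈ disjointCompl D ↔ ∀ a ∈ D, |x| ⊓ |a| = 0 := Iff.rfl

/-- The intersection of two bands. -/
def inter (A B : Band E) : Band E where
  toSubmodule := A.toSubmodule ⊓ B.toSubmodule
  solid := fun x hx y hy => ⟨A.solid x hx.1 y hy, B.solid x hx.2 y hy⟩
  isLUB_mem := fun S hS x hx =>
    ⟨A.isLUB_mem S (fun _ hs => (hS hs).1) x hx, B.isLUB_mem S (fun _ hs => (hS hs).2) x hx⟩

/-- The zero band. -/
def zeroBand : Band E where
  toSubmodule := ⊥
  solid := by
    intro x hx y hy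
    have hx' : x = 0 := hx
    subst hx'
    have : |y| ≤ 0 := by simpa using hy
    have h1 : y ≤ 0 := (le_abs_self y).trans this
    have h2 : -y ≤ 0 := (neg_le_abs y).trans this
    exact le_antisymm h1 (by simpa using h2)
  isLUB_mem := by
    intro S hS x hx
    rcases S.eq_empty_or_nonempty with rfl | ⟨s, hs⟩
    · exact isLUB_empty_eq_zero hx
    · have hs0 : s = 0 := hS hs
      have h1 : (0 : E) ≤ x := hs0 ▸ hx.1 hs
      have h2 : x ≤ 0 := hx.2 (fun t ht => (show t = 0 from hS ht).le)
      exact le_antisymm h2 h1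

/-- The whole space as a band. -/
def wholeBand : Band E where
  toSubmodule := ⊤
  solid := fun _ _ _ _ => trivial
  isLUB_mem := fun _ _ _ _ => trivial

theorem eq_zero_of_disjoint_self {x : E} (h : |x| ⊓ |x| = 0) : x = 0 := by
  rw [inf_idem] at h
  exact le_antisymm (h ▸ le_abs_self x) (by simpa using (h ▸ neg_le_abs x : -x ≤ 0))

theorem le_disjointCompl_iff (A B : Band E) :
    A ≤ disjointCompl (B : Set E) ↔ ∀ x ∈ A, x ∈ B → x = 0 := by
  constructor
  · intro h x hA hB
    exact eq_zero_of_disjoint_self (h hA x hB)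
  · intro h x hA b hb
    have hn : 0 ≤ |x| ⊓ |b| := le_inf (abs_nonneg _) (abs_nonneg _)
    exact h _ (mem_of_le (abs_mem hA) hn inf_le_left) (mem_of_le (abs_mem hb) hn inf_le_right)

end riesz

section archimedean

variable {E : Type u} [AddCommGroup E] [Lattice E] [Module ℝ E] [ArchimedeanRieszSpace E]

/-- In an Archimedean Riesz space a band is its own double disjoint complement. -/
theorem disjointCompl_disjointCompl (A : Band E) :
    disjointCompl (disjointCompl (A : Set E) : Set E) = A := by
  apply le_antisymm
  · intro x hx
    apply mem_of_abs_mem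
    set u := |x| with hu
    have hu0 : 0 ≤ u := abs_nonneg x
    have hux : u ∈ disjointCompl (disjointCompl (A : Set E) : Set E) := abs_mem hx
    refine A.isLUB_mem {a | a ∈ A ∧ 0 ≤ a ∧ a ≤ u} (fun a ha => ha.1) u
      ⟨fun a ha => ha.2.2, fun v hv => ?_⟩
    have h0S : (0 : E) ∈ {a | a ∈ A ∧ 0 ≤ a ∧ a ≤ u} := ⟨A.zero_mem, le_rfl, hu0⟩
    have hv0 : 0 ≤ v ⊓ u := le_inf (hv h0S) hu0
    have hw0 : 0 ≤ u - v ⊓ u := sub_nonneg.2 inf_le_right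
    have hwu : u - v ⊓ u ≤ u := sub_le_self _ hv0
    have hwd : u - v ⊓ u ∈ disjointCompl (A : Set E) := by
      intro a ha
      rw [abs_of_nonneg hw0]
      set b := (u - v ⊓ u) ⊓ |a| with hb
      have hb0 : 0 ≤ b := le_inf hw0 (abs_nonneg a)
      have hbA : b ∈ A := mem_of_le (abs_mem ha) hb0 inf_le_right
      have hn : ∀ n : ℕ, n • b ≤ u := by
        intro n
        induction n with
        | zero => simpa using hu0
        | succ n ih =>
          have hmem : n • b ∈ {a | a ∈ A ∧ 0 ≤ a ∧ a ≤ u} :=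
            ⟨A.toSubmodule.smul_of_tower_mem n hbA, nsmul_nonneg hb0 n, ih⟩
          calc (n + 1) • b = n • b + b := succ_nsmul b n
            _ ≤ v ⊓ u + (u - v ⊓ u) := add_le_add (le_inf (hv hmem) ih) inf_le_left
            _ = u := by abel
      exact le_antisymm (ArchimedeanRieszSpace.le_zero_of_forall_nsmul_le b u hn) hb0
    have hw := eq_zero_of_disjoint_self (mem_of_le hux hw0 hwu _ hwd)
    have : u = v ⊓ u := sub_eq_zero.1 hw
    rw [this]
    exact inf_le_left
  · intro x hx d hd
    rw [inf_comm]
    exact hd x hx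

theorem disjointCompl_anti {A B : Band E} (h : A ≤ B) :
    disjointCompl (B : Set E) ≤ disjointCompl (A : Set E) :=
  fun _ hx a ha => hx a (h ha)

instance : Min (Band E) := ⟨inter⟩
instance : Max (Band E) :=
  ⟨fun A B => disjointCompl (inter (disjointCompl (A : Set E)) (disjointCompl (B : Set E)) : Set E)⟩
instance : Compl (Band E) := ⟨fun A => disjointCompl (A : Set E)⟩
instance : Bot (Band E) := ⟨zeroBand⟩
instance : Top (Band E) := ⟨wholeBand⟩

/-- Bands ordered by inclusion form a lattice. -/
instance : Lattice (Band E) where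
  inf := (· ⊓ ·)
  sup := (· ⊔ ·)
  inf_le_left := fun _ _ _ hx => hx.1
  inf_le_right := fun _ _ _ hx => hx.2
  le_inf := fun _ _ _ h₁ h₂ _ hx => ⟨h₁ hx, h₂ hx⟩
  le_sup_left := by
    intro A B
    conv_lhs => rw [← disjointCompl_disjointCompl A]
    exact disjointCompl_anti (fun _ hx => hx.1)
  le_sup_right := by
    intro A B
    conv_lhs => rw [← disjointCompl_disjointCompl B]
    exact disjointCompl_anti (fun _ hx => hx.2)
  sup_le := by
    intro A B C h₁ h₂
    rw [← disjointCompl_disjointCompl C]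
    exact disjointCompl_anti (fun _ hx => ⟨disjointCompl_anti h₁ hx, disjointCompl_anti h₂ hx⟩)

instance : BoundedOrder (Band E) where
  le_top := fun _ _ _ => trivial
  bot_le := by
    intro A x hx
    have hx0 : x = 0 := hx
    rw [hx0]
    exact A.zero_mem

theorem le_compl_iff (A B : Band E) : A ≤ Bᶜ ↔ A ⊓ B = ⊥ := by
  refine (le_disjointCompl_iff A B).trans ⟨fun h => ?_, fun h x hA hB => ?_⟩
  · exact le_bot_iff.1 (fun x hx => h x hx.1 hx.2)
  · have : x ∈ (⊥ : Band E) := h ▸ (show x ∈ A ⊓ B from ⟨hA, hB⟩)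
    exact this

theorem compl_compl_eq (A : Band E) : Aᶜᶜ = A := disjointCompl_disjointCompl A

theorem inf_sup_le_aux (A B C : Band E) : A ⊓ (B ⊔ C) ≤ (A ⊓ B) ⊔ (A ⊓ C) := by
  rw [← compl_compl_eq ((A ⊓ B) ⊔ (A ⊓ C)), le_compl_iff]
  set W := (A ⊓ B) ⊔ (A ⊓ C) with hW
  have hWd : W ⊓ Wᶜ = ⊥ := by rw [← le_compl_iff, compl_compl_eq]
  have hB : B ≤ (A ⊓ Wᶜ)ᶜ := by
    rw [le_compl_iff]
    refine le_bot_iff.1 (le_trans (le_inf ?_ ?_) hWd.le)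
    · exact le_trans (le_inf (inf_le_right.trans inf_le_left) inf_le_left) le_sup_left
    · exact inf_le_right.trans inf_le_right
  have hC : C ≤ (A ⊓ Wᶜ)ᶜ := by
    rw [le_compl_iff]
    refine le_bot_iff.1 (le_trans (le_inf ?_ ?_) hWd.le)
    · exact le_trans (le_inf (inf_le_right.trans inf_le_left) inf_le_left) le_sup_right
    · exact inf_le_right.trans inf_le_right
  have h := (le_compl_iff _ _).1 (sup_le hB hC)
  refine le_bot_iff.1 (le_trans (le_inf ?_ (le_inf ?_ ?_)) h.le)
  · exact inf_le_left.trans inf_le_right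
  · exact inf_le_left.trans inf_le_left
  · exact inf_le_right

/-- The band algebra: the bands of an Archimedean Riesz space, ordered by inclusion, form a
Boolean algebra; the complement is the disjoint complement. -/
instance : BooleanAlgebra (Band E) where
  __ := (inferInstance : Lattice (Band E))
  __ := (inferInstance : BoundedOrder (Band E))
  compl := compl
  le_sup_inf := (DistribLattice.ofInfSupLe inf_sup_le_aux).le_sup_inf
  inf_compl_le_bot := by
    intro A
    have : A ⊓ Aᶜ = ⊥ := by rw [← le_compl_iff, compl_compl_eq]
    exact this.le
  top_le_sup_compl := by
    intro A
    rw [← compl_compl_eq (A ⊔ Aᶜ), le_compl_iff]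
    refine le_bot_iff.1 (fun x hx => ?_)
    have hx' : x ∈ (A ⊔ Aᶜ)ᶜ := hx.2
    have h₁ : x ∈ Aᶜ := disjointCompl_anti (le_sup_left : A ≤ A ⊔ Aᶜ) hx'
    have h₂ : x ∈ Aᶜᶜ := disjointCompl_anti (le_sup_right : Aᶜ ≤ A ⊔ Aᶜ) hx'
    exact eq_zero_of_disjoint_self (h₂ x h₁)

end archimedean

end Band

/-! ### Boolean algebras -/

/-- A Boolean homomorphism: a map preserving meets, symmetric differences and the unit. -/
structure IsBooleanHom {A : Type u} {B : Type v} [BooleanAlgebra A] [BooleanAlgebra B]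
    (χ : A → B) : Prop where
  map_inf : ∀ x y : A, χ (x ⊓ y) = χ x ⊓ χ y
  map_symmDiff : ∀ x y : A, χ (symmDiff x y) = symmDiff (χ x) (χ y)
  map_top : χ ⊤ = ⊤

/-- Two Boolean algebras are Boolean isomorphic if there is a bijective Boolean homomorphism
between them. -/
def BooleanIsomorphic (A : Type u) (B : Type v) [BooleanAlgebra A] [BooleanAlgebra B] : Prop :=
  ∃ χ : A → B, IsBooleanHom χ ∧ Function.Bijective χ

/-- A Boolean algebra is complete if every nonempty subset has a supremum. -/
def IsCompleteBooleanAlgebra (A : Type u) [BooleanAlgebra A] : Prop :=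
  ∀ S : Set A, S.Nonempty → ∃ x : A, IsLUB S x

/-- The Stone space of a Boolean algebra: the (unital, equivalently nonzero) ring homomorphisms
to `ℤ/2`, with the topology generated by the sets `{z | z a = 1}`. -/
abbrev StoneSpace (A : Type u) [BooleanAlgebra A] : Type u := AsBoolRing A →+* ZMod 2

namespace StoneSpace

/-- The subset of the Stone space that represents `a`. -/
def hat {A : Type u} [BooleanAlgebra A] (a : A) : Set (StoneSpace A) :=
  {z | z (toBoolRing a) = 1}

instance (A : Type u) [BooleanAlgebra A] : TopologicalSpace (StoneSpace A) :=
  TopologicalSpace.generateFrom (Set.range hat)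

end StoneSpace

/-- The free product of two Boolean algebras: the algebra of open-and-closed subsets of the
product of their Stone spaces. -/
abbrev FreeProduct (A : Type u) (B : Type v) [BooleanAlgebra A] [BooleanAlgebra B] :
    Type (max u v) :=
  TopologicalSpace.Clopens (StoneSpace A × StoneSpace B)

/-! ### The Archimedean Riesz space tensor product

It is built by generators and relations: formal Riesz space expressions in the symbols `x ⊗ y`,
modulo the smallest congruence that makes the quotient an Archimedean Riesz space and `⊗` a Riesz
bimorphism. The universal property is proved at the end. -/

namespace FremlinTensor

/-- Formal Riesz space expressions in the symbols `x ⊗ y`. -/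
inductive FormalExpr (E : Type u) (F : Type v) : Type (max u v)
  | tmul : E → F → FormalExpr E F
  | zero : FormalExpr E F
  | add (a b : FormalExpr E F) : FormalExpr E F
  | neg (a : FormalExpr E F) : FormalExpr E F
  | smul (r : ℝ) (a : FormalExpr E F) : FormalExpr E F
  | sup (a b : FormalExpr E F) : FormalExpr E F
  | inf (a b : FormalExpr E F) : FormalExpr E F

open FremlinTensor.FormalExpr

/-- The congruence defining the tensor product. -/
inductive Rel (E : Type u) (F : Type v) [AddCommGroup E] [Lattice E] [Module ℝ E]
    [AddCommGroup F] [Lattice F] [Module ℝ F] : FormalExpr E F → FormalExpr E F → Prop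
  -- a congruence
  | refl (a) : Rel E F a a
  | symm {a b} : Rel E F a b → Rel E F b a
  | trans {a b c} : Rel E F a b → Rel E F b c → Rel E F a c
  | add_congr {a a' b b'} : Rel E F a a' → Rel E F b b' → Rel E F (add a b) (add a' b')
  | neg_congr {a a'} : Rel E F a a' → Rel E F (neg a) (neg a')
  | smul_congr (r : ℝ) {a a'} : Rel E F a a' → Rel E F (smul r a) (smul r a')
  | sup_congr {a a' b b'} : Rel E F a a' → Rel E F b b' → Rel E F (sup a b) (sup a' b')
  | inf_congr {a a' b b'} : Rel E F a a' → Rel E F b b' → Rel E F (inf a b) (inf a' b')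
  -- real vector spaces
  | add_assoc (a b c) : Rel E F (add (add a b) c) (add a (add b c))
  | add_comm (a b) : Rel E F (add a b) (add b a)
  | zero_add (a) : Rel E F (add zero a) a
  | neg_add_cancel (a) : Rel E F (add (neg a) a) zero
  | smul_add (r : ℝ) (a b) : Rel E F (smul r (add a b)) (add (smul r a) (smul r b))
  | add_smul (r s : ℝ) (a) : Rel E F (smul (r + s) a) (add (smul r a) (smul s a))
  | mul_smul (r s : ℝ) (a) : Rel E F (smul (r * s) a) (smul r (smul s a))
  | one_smul (a) : Rel E F (smul 1 a) a
  -- lattices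
  | sup_comm (a b) : Rel E F (sup a b) (sup b a)
  | sup_assoc (a b c) : Rel E F (sup (sup a b) c) (sup a (sup b c))
  | inf_comm (a b) : Rel E F (inf a b) (inf b a)
  | inf_assoc (a b c) : Rel E F (inf (inf a b) c) (inf a (inf b c))
  | sup_inf_self (a b) : Rel E F (sup a (inf a b)) a
  | inf_sup_self (a b) : Rel E F (inf a (sup a b)) a
  -- compatibility of the order with the linear structure
  | add_sup (a b c) : Rel E F (add a (sup b c)) (sup (add a b) (add a c))
  | smul_sup (r : ℝ) (a b) : 0 ≤ r → Rel E F (smul r (sup a b)) (sup (smul r a) (smul r b))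
  -- the Archimedean property: if `n a ≤ b` for all `n`, then `a ≤ 0`
  | arch (a b) : (∀ n : ℕ, Rel E F (sup (smul (n : ℝ) a) b) b) → Rel E F (sup a zero) zero
  -- `⊗` is a Riesz bimorphism
  | add_tmul (x x' : E) (y : F) : Rel E F (tmul (x + x') y) (add (tmul x y) (tmul x' y))
  | tmul_add (x : E) (y y' : F) : Rel E F (tmul x (y + y')) (add (tmul x y) (tmul x y'))
  | smul_tmul (r : ℝ) (x : E) (y : F) : Rel E F (tmul (r • x) y) (smul r (tmul x y))
  | tmul_smul (r : ℝ) (x : E) (y : F) : Rel E F (tmul x (r • y)) (smul r (tmul x y))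
  | sup_tmul (x x' : E) (y : F) : 0 ≤ y →
      Rel E F (tmul (x ⊔ x') y) (sup (tmul x y) (tmul x' y))
  | inf_tmul (x x' : E) (y : F) : 0 ≤ y →
      Rel E F (tmul (x ⊓ x') y) (inf (tmul x y) (tmul x' y))
  | tmul_sup (x : E) (y y' : F) : 0 ≤ x →
      Rel E F (tmul x (y ⊔ y')) (sup (tmul x y) (tmul x y'))
  | tmul_inf (x : E) (y y' : F) : 0 ≤ x →
      Rel E F (tmul x (y ⊓ y')) (inf (tmul x y) (tmul x y'))

/-- The congruence as a setoid. -/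
def relSetoid (E : Type u) (F : Type v) [AddCommGroup E] [Lattice E] [Module ℝ E]
    [AddCommGroup F] [Lattice F] [Module ℝ F] : Setoid (FormalExpr E F) :=
  ⟨Rel E F, Rel.refl, Rel.symm, Rel.trans⟩

end FremlinTensor

/-- The (Fremlin) Archimedean Riesz space tensor product of `E` and `F`. -/
def FremlinTensor (E : Type u) (F : Type v) [AddCommGroup E] [Lattice E] [Module ℝ E]
    [AddCommGroup F] [Lattice F] [Module ℝ F] : Type (max u v) :=
  Quotient (FremlinTensor.relSetoid E F)

namespace FremlinTensor

section structures

variable {E : Type u} {F : Type v} [AddCommGroup E] [Lattice E] [Module ℝ E]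
  [AddCommGroup F] [Lattice F] [Module ℝ F]

/-- The class of an expression. -/
def mk (a : FormalExpr E F) : FremlinTensor E F := Quotient.mk (relSetoid E F) a

theorem mk_eq {a b : FormalExpr E F} (h : Rel E F a b) : mk a = mk b := Quotient.sound h

theorem rel_of_mk_eq {a b : FormalExpr E F} (h : mk a = mk b) : Rel E F a b := Quotient.exact h

theorem ind {p : FremlinTensor E F → Prop} (h : ∀ a, p (mk a)) (x) : p x := Quotient.ind h x

instance : Zero (FremlinTensor E F) := ⟨mk FormalExpr.zero⟩
instance : Add (FremlinTensor E F) :=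
  ⟨Quotient.map₂ FormalExpr.add fun _ _ h₁ _ _ h₂ => Rel.add_congr h₁ h₂⟩
instance : Neg (FremlinTensor E F) := ⟨Quotient.map FormalExpr.neg fun _ _ h => Rel.neg_congr h⟩
instance : SMul ℝ (FremlinTensor E F) :=
  ⟨fun r => Quotient.map (FormalExpr.smul r) fun _ _ h => Rel.smul_congr r h⟩
instance : Max (FremlinTensor E F) :=
  ⟨Quotient.map₂ FormalExpr.sup fun _ _ h₁ _ _ h₂ => Rel.sup_congr h₁ h₂⟩
instance : Min (FremlinTensor E F) :=
  ⟨Quotient.map₂ FormalExpr.inf fun _ _ h₁ _ _ h₂ => Rel.inf_congr h₁ h₂⟩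

instance : AddCommGroup (FremlinTensor E F) where
  add_assoc x y z := by
    induction x using ind; induction y using ind; induction z using ind
    exact mk_eq (Rel.add_assoc _ _ _)
  zero_add x := by
    induction x using ind
    exact mk_eq (Rel.zero_add _)
  add_zero x := by
    induction x using ind
    exact mk_eq ((Rel.add_comm _ _).trans (Rel.zero_add _))
  neg_add_cancel x := by
    induction x using ind
    exact mk_eq (Rel.neg_add_cancel _)
  add_comm x y := by
    induction x using ind; induction y using ind
    exact mk_eq (Rel.add_comm _ _)
  nsmul := nsmulRec
  zsmul := zsmulRec

instance : Module ℝ (FremlinTensor E F) :=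
  Module.ofMinimalAxioms
    (fun r x y => by
      induction x using ind; induction y using ind
      exact mk_eq (Rel.smul_add _ _ _))
    (fun r s x => by
      induction x using ind
      exact mk_eq (Rel.add_smul _ _ _))
    (fun r s x => by
      induction x using ind
      exact mk_eq (Rel.mul_smul _ _ _))
    (fun x => by
      induction x using ind
      exact mk_eq (Rel.one_smul _))

/-- The order of the tensor product: `x ≤ y` means `x ⊔ y = y`. -/
instance : PartialOrder (FremlinTensor E F) where
  le x y := x ⊔ y = y
  le_refl x := by
    induction x using ind with | _ a
    refine mk_eq (Rel.trans (Rel.sup_congr (Rel.refl a) (Rel.symm ?_)) (Rel.sup_inf_self a (.sup a a)))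
    exact Rel.inf_sup_self a a
  le_trans x y z := by
    induction x using ind; induction y using ind; induction z using ind
    intro h₁ h₂
    have h₁' := rel_of_mk_eq h₁
    have h₂' := rel_of_mk_eq h₂
    exact mk_eq ((Rel.sup_congr (Rel.refl _) h₂'.symm).trans
      ((Rel.sup_assoc _ _ _).symm.trans ((Rel.sup_congr h₁' (Rel.refl _)).trans h₂')))
  le_antisymm x y := by
    induction x using ind; induction y using ind
    intro h₁ h₂
    exact mk_eq ((rel_of_mk_eq h₂).symm.trans ((Rel.sup_comm _ _).trans (rel_of_mk_eq h₁)))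

theorem le_iff_sup_eq (x y : FremlinTensor E F) : x ≤ y ↔ x ⊔ y = y := Iff.rfl

instance : Lattice (FremlinTensor E F) where
  sup := (· ⊔ ·)
  inf := (· ⊓ ·)
  le_sup_left x y := by
    have h : x ⊔ x = x := le_refl x
    induction x using ind; induction y using ind
    exact mk_eq ((Rel.sup_assoc _ _ _).symm.trans (Rel.sup_congr (rel_of_mk_eq h) (Rel.refl _)))
  le_sup_right x y := by
    have h : y ⊔ y = y := le_refl y
    induction x using ind; induction y using ind
    exact mk_eq ((Rel.sup_comm _ _).trans ((Rel.sup_assoc _ _ _).trans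
      (Rel.sup_congr (Rel.refl _) (rel_of_mk_eq h))))
  sup_le x y z := by
    induction x using ind; induction y using ind; induction z using ind
    intro h₁ h₂
    exact mk_eq ((Rel.sup_assoc _ _ _).trans
      ((Rel.sup_congr (Rel.refl _) (rel_of_mk_eq h₂)).trans (rel_of_mk_eq h₁)))
  inf_le_left x y := by
    induction x using ind; induction y using ind
    exact mk_eq ((Rel.sup_comm _ _).trans (Rel.sup_inf_self _ _))
  inf_le_right x y := by
    induction x using ind; induction y using ind
    exact mk_eq ((Rel.sup_comm _ _).trans
      ((Rel.sup_congr (Rel.refl _) (Rel.inf_comm _ _)).trans (Rel.sup_inf_self _ _)))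
  le_inf x y z := by
    induction x using ind with | _ a
    induction y using ind with | _ b
    induction z using ind with | _ c
    intro h₁ h₂
    have key : ∀ d, Rel E F (.sup a d) d → Rel E F (.inf a d) a := fun d h =>
      (Rel.inf_congr (Rel.refl _) h.symm).trans (Rel.inf_sup_self _ _)
    have e : Rel E F (.inf a (.inf b c)) a :=
      (Rel.inf_assoc _ _ _).symm.trans ((Rel.inf_congr (key b (rel_of_mk_eq h₁)) (Rel.refl _)).trans
        (key c (rel_of_mk_eq h₂)))
    refine mk_eq ((Rel.sup_comm _ _).trans ((Rel.sup_congr (Rel.refl _) ?_).trans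
      (Rel.sup_inf_self _ a)))
    exact e.symm.trans (Rel.inf_comm _ _)

theorem add_sup_eq (x y z : FremlinTensor E F) : x + (y ⊔ z) = (x + y) ⊔ (x + z) := by
  induction x using ind; induction y using ind; induction z using ind
  exact mk_eq (Rel.add_sup _ _ _)

theorem smul_sup_eq {r : ℝ} (hr : 0 ≤ r) (x y : FremlinTensor E F) :
    r • (x ⊔ y) = r • x ⊔ r • y := by
  induction x using ind; induction y using ind
  exact mk_eq (Rel.smul_sup _ _ _ hr)

instance : RieszSpace (FremlinTensor E F) where
  add_le_add_left x y h z := by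
    rw [le_iff_sup_eq] at h ⊢
    rw [add_comm x z, add_comm y z, ← add_sup_eq, h]
  smul_le_smul_of_nonneg_left r hr x y h := by
    rw [le_iff_sup_eq] at h ⊢
    rw [← smul_sup_eq hr, h]

instance : ArchimedeanRieszSpace (FremlinTensor E F) where
  le_zero_of_forall_nsmul_le x y h := by
    have h' : ∀ n : ℕ, (n : ℝ) • x ⊔ y = y := fun n => by
      rw [Nat.cast_smul_eq_nsmul ℝ]
      exact h n
    induction x using ind with | _ a
    induction y using ind with | _ b
    exact mk_eq (Rel.arch a b fun n => rel_of_mk_eq (h' n))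

/-- The canonical bilinear map `(x, y) ↦ x ⊗ y`. -/
def tmul (E : Type u) (F : Type v) [AddCommGroup E] [Lattice E] [Module ℝ E]
    [AddCommGroup F] [Lattice F] [Module ℝ F] : E →ₗ[ℝ] F →ₗ[ℝ] FremlinTensor E F :=
  LinearMap.mk₂ ℝ (fun x y => mk (FormalExpr.tmul x y))
    (fun _ _ _ => mk_eq (Rel.add_tmul _ _ _)) (fun _ _ _ => mk_eq (Rel.smul_tmul _ _ _))
    (fun _ _ _ => mk_eq (Rel.tmul_add _ _ _)) (fun _ _ _ => mk_eq (Rel.tmul_smul _ _ _))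

theorem isRieszBimorphism_tmul : IsRieszBimorphism (tmul E F) where
  left _ hx :=
    ⟨fun _ _ => mk_eq (Rel.tmul_sup _ _ _ hx), fun _ _ => mk_eq (Rel.tmul_inf _ _ _ hx)⟩
  right _ hy :=
    ⟨fun _ _ => mk_eq (Rel.sup_tmul _ _ _ hy), fun _ _ => mk_eq (Rel.inf_tmul _ _ _ hy)⟩

end structures

section universal

variable {E : Type u} {F : Type v} {H : Type w} [AddCommGroup E] [Lattice E] [Module ℝ E]
  [AddCommGroup F] [Lattice F] [Module ℝ F] [AddCommGroup H] [Lattice H] [Module ℝ H]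

/-- The value of an expression under a bilinear map. -/
def eval (ψ : E →ₗ[ℝ] F →ₗ[ℝ] H) : FormalExpr E F → H
  | .tmul x y => ψ x y
  | .zero => 0
  | .add a b => eval ψ a + eval ψ b
  | .neg a => -eval ψ a
  | .smul r a => r • eval ψ a
  | .sup a b => eval ψ a ⊔ eval ψ b
  | .inf a b => eval ψ a ⊓ eval ψ b

theorem smul_sup_of_nonneg [RieszSpace H] {r : ℝ} (hr : 0 ≤ r) (x y : H) :
    r • (x ⊔ y) = r • x ⊔ r • y := by
  rcases hr.eq_or_lt with rfl | hr'
  · simp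
  apply le_antisymm
  · have h : x ⊔ y ≤ r⁻¹ • (r • x ⊔ r • y) := by
      apply sup_le
      · have := smul_le_smul_of_nonneg_left (le_sup_left : r • x ≤ r • x ⊔ r • y)
          (inv_nonneg.2 hr)
        rwa [inv_smul_smul₀ hr'.ne'] at this
      · have := smul_le_smul_of_nonneg_left (le_sup_right : r • y ≤ r • x ⊔ r • y)
          (inv_nonneg.2 hr)
        rwa [inv_smul_smul₀ hr'.ne'] at this
    have := smul_le_smul_of_nonneg_left h hr
    rwa [smul_inv_smul₀ hr'.ne'] at this
  · exact sup_le (smul_le_smul_of_nonneg_left le_sup_left hr)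
      (smul_le_smul_of_nonneg_left le_sup_right hr)

theorem eval_eq [ArchimedeanRieszSpace H] {ψ : E →ₗ[ℝ] F →ₗ[ℝ] H} (hψ : IsRieszBimorphism ψ)
    {a b : FormalExpr E F} (h : Rel E F a b) : eval ψ a = eval ψ b := by
  induction h with
  | refl a => rfl
  | symm _ ih => exact ih.symm
  | trans _ _ ih₁ ih₂ => exact ih₁.trans ih₂
  | add_congr _ _ ih₁ ih₂ => simp only [eval, ih₁, ih₂]
  | neg_congr _ ih => simp only [eval, ih]
  | smul_congr r _ ih => simp only [eval, ih]
  | sup_congr _ _ ih₁ ih₂ => simp only [eval, ih₁, ih₂]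
  | inf_congr _ _ ih₁ ih₂ => simp only [eval, ih₁, ih₂]
  | add_assoc a b c => exact _root_.add_assoc _ _ _
  | add_comm a b => exact _root_.add_comm _ _
  | zero_add a => exact _root_.zero_add _
  | neg_add_cancel a => exact _root_.neg_add_cancel _
  | smul_add r a b => exact _root_.smul_add _ _ _
  | add_smul r s a => exact _root_.add_smul _ _ _
  | mul_smul r s a => exact SemigroupAction.mul_smul _ _ _
  | one_smul a => exact _root_.one_smul _ _
  | sup_comm a b => exact _root_.sup_comm _ _
  | sup_assoc a b c => exact _root_.sup_assoc _ _ _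
  | inf_comm a b => exact _root_.inf_comm _ _
  | inf_assoc a b c => exact _root_.inf_assoc _ _ _
  | sup_inf_self a b => exact _root_.sup_inf_self
  | inf_sup_self a b => exact _root_.inf_sup_self
  | add_sup a b c => exact _root_.add_sup _ _ _
  | smul_sup r a b hr => exact smul_sup_of_nonneg hr _ _
  | arch a b _ ih =>
    refine sup_eq_right.2 (ArchimedeanRieszSpace.le_zero_of_forall_nsmul_le _ (eval ψ b) ?_)
    intro n
    rw [← Nat.cast_smul_eq_nsmul ℝ]
    exact sup_eq_right.1 (ih n)
  | add_tmul x x' y => simp [eval]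
  | tmul_add x y y' => simp [eval]
  | smul_tmul r x y => simp [eval]
  | tmul_smul r x y => simp [eval]
  | sup_tmul x x' y hy => exact (hψ.right y hy).map_sup x x'
  | inf_tmul x x' y hy => exact (hψ.right y hy).map_inf x x'
  | tmul_sup x y y' hx => exact (hψ.left x hx).map_sup y y'
  | tmul_inf x y y' hx => exact (hψ.left x hx).map_inf y y'

/-- The universal property: every Riesz bimorphism from `E × F` to an Archimedean Riesz space
factors through `⊗` by a unique Riesz homomorphism. -/
theorem existsUnique_rieszHom [ArchimedeanRieszSpace H] (ψ : E →ₗ[ℝ] F →ₗ[ℝ] H)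
    (hψ : IsRieszBimorphism ψ) :
    ∃! T : FremlinTensor E F →ₗ[ℝ] H, IsRieszHom T ∧ ∀ x y, T (tmul E F x y) = ψ x y := by
  let t : FremlinTensor E F → H := Quotient.lift (eval ψ) fun _ _ h => eval_eq hψ h
  refine ⟨{ toFun := t, map_add' := ?_, map_smul' := ?_ }, ⟨⟨?_, ?_⟩, fun _ _ => rfl⟩, ?_⟩
  · intro x y
    induction x using ind; induction y using ind
    rfl
  · intro r x
    induction x using ind
    rfl
  · intro x y
    induction x using ind; induction y using ind
    rfl
  · intro x y
    induction x using ind; induction y using ind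
    rfl
  · rintro S ⟨hS, hS'⟩
    ext x
    induction x using ind with | _ a
    change S (mk a) = eval ψ a
    induction a with
    | tmul x y => exact hS' x y
    | zero => exact S.map_zero
    | add a b iha ihb => exact (S.map_add (mk a) (mk b)).trans (by rw [iha, ihb]; rfl)
    | neg a ih => exact (S.map_neg (mk a)).trans (by rw [ih]; rfl)
    | smul r a ih => exact (S.map_smul r (mk a)).trans (by rw [ih]; rfl)
    | sup a b iha ihb => exact (hS.map_sup (mk a) (mk b)).trans (by rw [iha, ihb]; rfl)
    | inf a b iha ihb => exact (hS.map_inf (mk a) (mk b)).trans (by rw [iha, ihb]; rfl)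

end universal

end FremlinTensor

/-! ### Disjoint sequences in Boolean algebras -/

/-! Completeness separates the two algebras, and it is invariant under Boolean isomorphism. Of the
tensor product, only the fact that it is an Archimedean Riesz space matters. In any such space bands
are their own double disjoint complements, so the double disjoint complement of a union of bands is
their supremum.

The free product fails to be complete as soon as both factors have infinite disjoint sequences `a
n`, `b n` of nonzero elements. A supremum of the diagonal rectangles `a n × b n` would be clopen in
a compact product, hence a finite union of clopen rectangles. By pigeonhole one of these meets two
different diagonal rectangles, so it also contains a point of some `a m × b n` with `m ≠ n`. That
off-diagonal rectangle misses the whole diagonal, so removing it leaves a smaller upper bound.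

Infinite dimension supplies the disjoint sequences. Without one, the band algebra satisfies the
descending chain condition, so it is atomic, and it has finitely many atoms. For `a > 0` in an atom,
every vector is a multiple of `a` plus a vector disjoint from `a`
(`exists_sub_smul_mem_disjointCompl`, a Dedekind cut argument). One such `a` per atom then spans the
space. -/

/-- In a Boolean algebra without infinite disjoint sequences of nonzero elements, every strictly
descending chain is finite. -/
theorem wellFoundedLT_of_no_disjoint_sequence {A : Type u} [BooleanAlgebra A]
    (h : ¬ ∃ f : ℕ → A, (∀ n, f n ≠ ⊥) ∧ ∀ m n, m ≠ n → Disjoint (f m) (f n)) :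
    WellFoundedLT A := by
  refine ⟨wellFounded_iff_isEmpty_descending_chain.2 ⟨fun ⟨c, hc⟩ => h ?_⟩⟩
  have hanti : StrictAnti c := strictAnti_nat_of_succ_lt hc
  -- For `m < n` the later difference lies below `c (m + 1)`, which the earlier one avoids.
  have key : ∀ m n, m < n → Disjoint (c m \ c (m + 1)) (c n \ c (n + 1)) := fun m n hmn =>
    disjoint_sdiff_self_left.mono_right
      (sdiff_le.trans (hanti.antitone hmn))
  refine ⟨fun n => c n \ c (n + 1), fun n h0 => ?_, fun m n hmn => ?_⟩
  · exact (hc n).not_ge (sdiff_eq_bot_iff.1 h0)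
  · rcases hmn.lt_or_gt with hlt | hlt
    · exact key m n hlt
    · exact (key n m hlt).symm

theorem finite_setOf_isAtom_of_no_disjoint_sequence {A : Type u} [BooleanAlgebra A]
    (h : ¬ ∃ f : ℕ → A, (∀ n, f n ≠ ⊥) ∧ ∀ m n, m ≠ n → Disjoint (f m) (f n)) :
    {a : A | IsAtom a}.Finite := by
  by_contra hinf
  have hinf : {a : A | IsAtom a}.Infinite := hinf
  let g := hinf.natEmbedding
  refine h ⟨fun n => (g n : A), fun n => (g n).2.1, fun m n hmn => ?_⟩
  exact (g m).2.disjoint_of_ne (g n).2 (fun e => hmn (g.injective (Subtype.ext e)))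

/-! ### The Stone space -/

namespace StoneSpace

variable {A : Type u} [BooleanAlgebra A]

theorem mem_hat (a : A) (z : StoneSpace A) : z ∈ hat a ↔ z (toBoolRing a) = 1 := Iff.rfl

theorem hat_compl (a : A) : hat aᶜ = (hat a)ᶜ := by
  ext z
  have h : z (toBoolRing a) + z (toBoolRing aᶜ) = 1 := by
    rw [← map_add, ← toBoolRing_symmDiff, symmDiff_compl_self, toBoolRing_top, map_one]
  rw [Set.mem_compl_iff, mem_hat, mem_hat]
  -- Two elements of `ℤ/2` with sum `1` are `0` and `1` in some order; this is a check of four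
  -- cases.
  generalize z (toBoolRing a) = s at h ⊢
  generalize z (toBoolRing aᶜ) = t at h ⊢
  revert s t
  decide

theorem isClopen_hat (a : A) : IsClopen (hat a) := by
  have ho : ∀ b : A, IsOpen (hat b) := fun b =>
    TopologicalSpace.isOpen_generateFrom_of_mem ⟨b, rfl⟩
  refine ⟨⟨?_⟩, ho a⟩
  rw [← hat_compl]
  exact ho _

theorem disjoint_hat {a b : A} (h : Disjoint a b) : Disjoint (hat a) (hat b) := by
  rw [Set.disjoint_left]
  intro z ha hb
  rw [mem_hat] at ha hb
  have : z (toBoolRing (a ⊓ b)) = 1 := by rw [toBoolRing_inf, map_mul, ha, hb, one_mul]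
  rw [h.eq_bot, toBoolRing_bot, map_zero] at this
  exact zero_ne_one this

/-- Every nonzero element of a Boolean algebra is detected by a point of the Stone space. -/
theorem hat_nonempty {a : A} (ha : a ≠ ⊥) : (hat a).Nonempty := by
  classical
  have hidem : ∀ r : AsBoolRing A, r * r = r := fun r => BooleanRing.isIdempotentElem r
  -- `1 + a` annihilates `a ≠ 0`, so some maximal ideal `M` contains it. The required point is the
  -- indicator of the complement of `M`.
  have hnu : ¬ IsUnit (1 + toBoolRing a) := by
    intro hu
    apply ha
    have h0 : (1 + toBoolRing a) * toBoolRing a = 0 := by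
      rw [add_mul, one_mul, hidem, BooleanRing.add_self]
    have := hu.mul_right_eq_zero.1 h0
    exact toBoolRing_inj.1 (this.trans toBoolRing_bot.symm)
  obtain ⟨M, hM, haM⟩ := exists_max_ideal_of_mem_nonunits hnu
  have hprime := hM.isPrime
  -- Since `r (1 + r) = 0`, the ideal `M` has exactly two cosets, so the indicator is additive.
  have hor : ∀ r : AsBoolRing A, r ∈ M ∨ 1 + r ∈ M := fun r => by
    apply hprime.mem_or_mem
    rw [mul_add, mul_one, hidem, BooleanRing.add_self]
    exact M.zero_mem
  have hne : (1 : AsBoolRing A) ∉ M := (Ideal.ne_top_iff_one M).1 hprime.ne_top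
  have hnot : ∀ r : AsBoolRing A, r ∈ M → 1 + r ∉ M := fun r h h' =>
    hne (by simpa using M.sub_mem h' h)
  have hadd : ∀ r s : AsBoolRing A, r ∉ M → s ∉ M → r + s ∈ M := fun r s hr hs => by
    have := M.add_mem ((hor r).resolve_left hr) ((hor s).resolve_left hs)
    have e : 1 + r + (1 + s) = (1 + 1) + (r + s) := by abel
    rwa [e, BooleanRing.add_self, zero_add] at this
  refine ⟨{ toFun := fun r => if r ∈ M then 0 else 1, map_one' := if_neg hne,
            map_zero' := if_pos M.zero_mem, map_mul' := fun r s => ?_,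
            map_add' := fun r s => ?_ }, ?_⟩
  · by_cases hr : r ∈ M
    · simp [hr, M.mul_mem_right s hr]
    · by_cases hs : s ∈ M
      · simp [hs, M.mul_mem_left r hs]
      · have : r * s ∉ M := fun h => (hprime.mem_or_mem h).elim hr hs
        simp [hr, hs, this]
  · by_cases hr : r ∈ M
    · by_cases hs : s ∈ M
      · simp [hr, hs, M.add_mem hr hs]
      · have : r + s ∉ M := fun h => hs ((M.add_mem_iff_right hr).1 h)
        simp [hr, hs, this]
    · by_cases hs : s ∈ M
      · have : r + s ∉ M := fun h => hr ((M.add_mem_iff_left hs).1 h)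
        simp [hr, hs, this]
      · simp only [hr, hs, hadd r s hr hs, if_true, if_false]
        decide
  · exact if_neg fun h => hnot _ h haM

/-- An ultrafilter converges to its pointwise limit: each evaluation takes values in the finite set
`ℤ/2`, so it is constant on a member of the ultrafilter. Each ring identity involves finitely many
evaluations and therefore survives in the limit. -/
instance : CompactSpace (StoneSpace A) := by
  refine ⟨isCompact_iff_ultrafilter_le_nhds.2 fun U _ => ?_⟩
  have hev : ∀ r : AsBoolRing A, ∃ t : ZMod 2, ∀ᶠ φ in (U : Filter (StoneSpace A)), φ r = t := by
    intro r
    obtain ⟨t, ht⟩ := (U.map fun φ : StoneSpace A => φ r).eq_pure_of_finite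
    refine ⟨t, ?_⟩
    have : ({t} : Set (ZMod 2)) ∈ U.map fun φ : StoneSpace A => φ r := by
      rw [ht]; exact Ultrafilter.mem_pure.2 rfl
    exact this
  choose z hz using hev
  refine ⟨{ toFun := z, map_one' := ?_, map_zero' := ?_, map_mul' := fun r s => ?_,
            map_add' := fun r s => ?_ }, Set.mem_univ _, ?_⟩
  · obtain ⟨φ, hφ⟩ := (hz 1).exists
    rw [← hφ, map_one]
  · obtain ⟨φ, h₁, h₂, h₃⟩ := ((hz (r * s)).and ((hz r).and (hz s))).exists
    rw [← h₁, ← h₂, ← h₃, map_mul]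
  · obtain ⟨φ, hφ⟩ := (hz 0).exists
    rw [← hφ, map_zero]
  · obtain ⟨φ, h₁, h₂, h₃⟩ := ((hz (r + s)).and ((hz r).and (hz s))).exists
    rw [← h₁, ← h₂, ← h₃, map_add]
  · rw [TopologicalSpace.nhds_generateFrom]
    refine le_iInf₂ fun s hs => Filter.le_principal_iff.2 ?_
    obtain ⟨hzs, a, rfl⟩ := hs
    filter_upwards [hz (toBoolRing a)] with φ hφ
    exact hφ.trans hzs

end StoneSpace

/-! ### Completeness -/

/-- A bijection preserving meets is an order isomorphism, because `x ≤ y` means `x ⊓ y = x`. -/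
theorem BooleanIsomorphic.isCompleteBooleanAlgebra {A : Type u} {B : Type v} [BooleanAlgebra A]
    [BooleanAlgebra B] (h : BooleanIsomorphic A B) (hB : IsCompleteBooleanAlgebra B) :
    IsCompleteBooleanAlgebra A := by
  obtain ⟨χ, hχ, hbij⟩ := h
  have hle : ∀ x y : A, χ x ≤ χ y ↔ x ≤ y := fun x y => by
    rw [← inf_eq_left, ← hχ.map_inf, hbij.injective.eq_iff, inf_eq_left]
  intro S hS
  obtain ⟨b, hb⟩ := hB (χ '' S) (hS.image χ)
  obtain ⟨a, rfl⟩ := hbij.surjective b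
  refine ⟨a, fun x hx => (hle x a).1 (hb.1 ⟨x, hx, rfl⟩), fun y hy => (hle a y).1 (hb.2 ?_)⟩
  rintro _ ⟨x, hx, rfl⟩
  exact (hle x y).2 (hy hx)

/-- The free product of two Boolean algebras, each of which has an infinite disjoint sequence of
nonzero elements, is not complete. -/
theorem FreeProduct.not_isCompleteBooleanAlgebra {A : Type u} {B : Type v} [BooleanAlgebra A]
    [BooleanAlgebra B]
    (hA : ∃ f : ℕ → A, (∀ n, f n ≠ ⊥) ∧ ∀ m n, m ≠ n → Disjoint (f m) (f n))
    (hB : ∃ f : ℕ → B, (∀ n, f n ≠ ⊥) ∧ ∀ m n, m ≠ n → Disjoint (f m) (f n)) :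
    ¬ IsCompleteBooleanAlgebra (FreeProduct A B) := by
  intro hc
  obtain ⟨a, ha0, had⟩ := hA
  obtain ⟨b, hb0, hbd⟩ := hB
  let R : ℕ → ℕ → FreeProduct A B := fun m n =>
    ⟨StoneSpace.hat (a m) ×ˢ StoneSpace.hat (b n),
      (StoneSpace.isClopen_hat (a m)).prod (StoneSpace.isClopen_hat (b n))⟩
  obtain ⟨C, hC⟩ := hc (Set.range fun n => R n n) (Set.range_nonempty _)
  choose x hx using fun n => StoneSpace.hat_nonempty (ha0 n)
  choose y hy using fun n => StoneSpace.hat_nonempty (hb0 n)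
  -- Compactness enters here: a clopen subset of the product is a finite union of clopen rectangles.
  obtain ⟨I, hI⟩ := TopologicalSpace.Clopens.exists_finset_eq_sup_prod C
  have hxy : ∀ n, ∃ i : I, (x n, y n) ∈ (i : TopologicalSpace.Clopens (StoneSpace A) ×
      TopologicalSpace.Clopens (StoneSpace B)).1 ×ˢ (i : TopologicalSpace.Clopens (StoneSpace A) ×
      TopologicalSpace.Clopens (StoneSpace B)).2 := by
    intro n
    have hn : (x n, y n) ∈ C := hC.1 ⟨n, rfl⟩ (show (x n, y n) ∈ R n n from ⟨hx n, hy n⟩)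
    rw [hI, ← SetLike.mem_coe, TopologicalSpace.Clopens.coe_finset_sup] at hn
    simp only [Set.mem_iUnion] at hn
    obtain ⟨i, hi, h⟩ := hn
    exact ⟨⟨i, hi⟩, h⟩
  choose g hg using hxy
  obtain ⟨m, n, hmn, hgmn⟩ := Finite.exists_ne_map_eq_of_infinite g
  -- A rectangle containing `(x m, y m)` and `(x n, y n)` also contains the mixed point.
  have hmem : (x m, y n) ∈ C := by
    rw [hI]
    have h1 := hg n
    rw [← hgmn] at h1
    exact (Finset.le_sup (f := fun i : TopologicalSpace.Clopens (StoneSpace A) ×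
      TopologicalSpace.Clopens (StoneSpace B) => i.1 ×ˢ i.2) (g m).2) ⟨(hg m).1, h1.2⟩
  -- Every index `k` differs from `m` or from `n`, so `R k k` misses `R m n` in one of the
  -- coordinates.
  have hub : C ≤ C \ R m n := by
    refine hC.2 ?_
    rintro _ ⟨k, rfl⟩
    refine le_sdiff.2 ⟨hC.1 ⟨k, rfl⟩, ?_⟩
    rw [disjoint_iff_inf_le]
    rintro ⟨p, q⟩ ⟨⟨hp, hq⟩, hp', hq'⟩
    by_cases hk : k = m
    · subst hk
      exact Set.disjoint_left.1 (StoneSpace.disjoint_hat (hbd k n hmn)) hq hq'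
    · exact Set.disjoint_left.1 (StoneSpace.disjoint_hat (had k m hk)) hp hp'
  exact (hub hmem).2 ⟨hx m, hy n⟩

/-! ### Bands of an Archimedean Riesz space -/

namespace Band

variable {E : Type u} [AddCommGroup E] [Lattice E] [Module ℝ E]

theorem subset_disjointCompl_disjointCompl [RieszSpace E] (D : Set E) :
    D ⊆ (disjointCompl (disjointCompl D : Set E) : Set E) := fun x hx y hy => by
  rw [inf_comm]
  exact hy x hx

/-- A band containing the union contains its double disjoint complement, being equal to its own. -/
theorem isCompleteBooleanAlgebra [ArchimedeanRieszSpace E] :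
    IsCompleteBooleanAlgebra (Band E) := by
  intro S _
  refine ⟨disjointCompl (disjointCompl (⋃ A ∈ S, (A : Set E)) : Set E),
    fun A hA x hx => ?_, fun B hB => ?_⟩
  · exact subset_disjointCompl_disjointCompl _ (Set.mem_biUnion hA hx)
  · rw [← disjointCompl_disjointCompl B]
    refine disjointCompl_anti fun x hx y hy => ?_
    obtain ⟨A, hA, hyA⟩ := Set.mem_iUnion₂.1 hy
    exact hx y (hB hA hyA)

/-! ### Atoms of the band algebra and finite dimension. -/

variable [ArchimedeanRieszSpace E]

theorem nsmul_inf_eq_zero {a b : E} (ha : 0 ≤ a) (hb : 0 ≤ b) (h : a ⊓ b = 0) (n : ℕ) :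
    a ⊓ n • b = 0 := by
  have h1 : b ∈ disjointCompl ({a} : Set E) := by
    rintro _ rfl
    rw [abs_of_nonneg hb, abs_of_nonneg ha, inf_comm, h]
  have h2 := (disjointCompl ({a} : Set E)).toSubmodule.smul_of_tower_mem n h1 a rfl
  rwa [abs_of_nonneg ha, abs_of_nonneg (nsmul_nonneg hb n), inf_comm] at h2

/-- If the positive parts of `n a - w` are all disjoint from `a ≥ 0`, then `a = 0`. -/
theorem eq_zero_of_forall_nsmul_sub_disjoint {a w : E} (ha : 0 ≤ a) (hw : 0 ≤ w)
    (h : ∀ n : ℕ, ((n • a - w) ⊔ 0) ⊓ a = 0) : a = 0 := by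
  refine le_antisymm (ArchimedeanRieszSpace.le_zero_of_forall_nsmul_le a w fun n => ?_) ha
  -- The positive part of `n a - w` is disjoint from `n a` but lies below it, so it vanishes and `n
  -- a ≤ w`.
  have h1 := nsmul_inf_eq_zero le_sup_right ha (h n) n
  have h2 : (n • a - w) ⊔ 0 ≤ n • a := sup_le (sub_le_self _ hw) (nsmul_nonneg ha n)
  rw [inf_eq_left.2 h2] at h1
  have := h1 ▸ (le_sup_left : n • a - w ≤ (n • a - w) ⊔ 0)
  exact sub_nonpos.1 this

/-- If the positive parts of `x - (n + 1)⁻¹ a` are all disjoint from `a ≥ 0`, then so is that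
of `x`. -/
theorem posPart_inf_eq_zero_of_forall_pos {a x : E} (ha : 0 ≤ a)
    (h : ∀ n : ℕ, ((x - ((n : ℝ) + 1)⁻¹ • a) ⊔ 0) ⊓ a = 0) : (x ⊔ 0) ⊓ a = 0 := by
  have hb0 : 0 ≤ (x ⊔ 0) ⊓ a := le_inf le_sup_right ha
  refine le_antisymm (ArchimedeanRieszSpace.le_zero_of_forall_nsmul_le _ a fun n => ?_) hb0
  have hp : (0 : ℝ) ≤ ((n : ℝ) + 1)⁻¹ := by positivity
  have hea : 0 ≤ ((n : ℝ) + 1)⁻¹ • a := smul_nonneg hp ha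
  -- With `ε = (n + 1)⁻¹`, the positive part of `x` is at most that of `x - ε a` plus `ε a`. Meeting
  -- with `a` leaves at most `ε a`, and the Archimedean property finishes.
  have h1 : x ⊔ 0 ≤ ((x - ((n : ℝ) + 1)⁻¹ • a) ⊔ 0) + ((n : ℝ) + 1)⁻¹ • a := by
    refine sup_le ?_ (add_nonneg le_sup_right hea)
    rw [← sub_le_iff_le_add]
    exact le_sup_left
  have h2 : (x ⊔ 0) ⊓ a ≤ ((n : ℝ) + 1)⁻¹ • a := by
    refine (inf_le_inf_right a h1).trans ((inf_add_le le_sup_right hea ha).trans ?_)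
    rw [h n, zero_add]
    exact inf_le_left
  have h3 : ((n : ℝ) + 1) • ((x ⊔ 0) ⊓ a) ≤ a := by
    have := smul_le_smul_of_nonneg_left h2 (show (0 : ℝ) ≤ (n : ℝ) + 1 by positivity)
    rwa [smul_inv_smul₀ (by positivity)] at this
  refine le_trans ?_ h3
  rw [← Nat.cast_smul_eq_nsmul ℝ, add_smul, one_smul]
  exact le_add_of_nonneg_right hb0

/-- If `a > 0` cannot meet both of two disjoint elements, then every element is a multiple of `a`
up to an element disjoint from `a`. -/
theorem exists_sub_smul_mem_disjointCompl {a : E} (ha : 0 ≤ a) (ha0 : a ≠ 0)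
    (hatom : ∀ p q : E, 0 ≤ p → 0 ≤ q → p ⊓ q = 0 → p ⊓ a = 0 ∨ q ⊓ a = 0) (x : E) :
    ∃ t : ℝ, x - t • a ∈ disjointCompl ({a} : Set E) := by
  have hmono : ∀ s t : ℝ, s ≤ t → x - t • a ≤ x - s • a := fun s t hst =>
    sub_le_sub_left (smul_le_smul_of_nonneg_right hst ha) x
  -- The positive and negative parts of `x - t a` are disjoint, so `a` misses one of them.
  have hdich : ∀ t : ℝ, ((x - t • a) ⊔ 0) ⊓ a = 0 ∨ ((t • a - x) ⊔ 0) ⊓ a = 0 := fun t => by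
    refine hatom _ _ le_sup_right le_sup_right ?_
    have := posPart_inf_negPart_eq_zero (x - t • a)
    rwa [posPart_def, negPart_def, neg_sub] at this
  -- The lower half of a Dedekind cut: the `t` for which `x` still exceeds `t a` somewhere on `a`.
  -- The required coefficient is its supremum.
  let L : Set ℝ := {t | ((x - t • a) ⊔ 0) ⊓ a ≠ 0}
  have hdown : ∀ s t, s ≤ t → t ∈ L → s ∈ L := by
    intro s t hst ht hs
    refine ht (le_antisymm ?_ (le_inf le_sup_right ha))
    exact (inf_le_inf_right a (sup_le_sup_right (hmono s t hst) 0)).trans hs.le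
  -- If `L` were empty or unbounded above, then `x + n a` or `n a - x` would have positive part
  -- disjoint from `a` for every `n`. Both dominate `n a - |x|`, which forces `a = 0`.
  have hL : L.Nonempty := by
    by_contra hne
    rw [Set.not_nonempty_iff_eq_empty] at hne
    refine ha0 (eq_zero_of_forall_nsmul_sub_disjoint ha (abs_nonneg x) fun n => ?_)
    have : (-(n : ℝ)) ∉ L := by rw [hne]; exact Set.notMem_empty _
    have h0 : ((x - (-(n : ℝ)) • a) ⊔ 0) ⊓ a = 0 := not_not.1 this
    refine le_antisymm ((inf_le_inf_right a (sup_le_sup_right ?_ 0)).trans h0.le)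
      (le_inf le_sup_right ha)
    rw [neg_smul, sub_neg_eq_add, Nat.cast_smul_eq_nsmul ℝ, sub_eq_neg_add]
    exact add_le_add_left (neg_le.1 (neg_le_abs x)) _
  have hbdd : BddAbove L := by
    by_contra hnb
    refine ha0 (eq_zero_of_forall_nsmul_sub_disjoint ha (abs_nonneg x) fun n => ?_)
    obtain ⟨t, ht, hnt⟩ := not_bddAbove_iff.1 hnb n
    have h0 := (hdich n).resolve_left (hdown _ _ hnt.le ht)
    refine le_antisymm ((inf_le_inf_right a (sup_le_sup_right ?_ 0)).trans h0.le)
      (le_inf le_sup_right ha)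
    rw [Nat.cast_smul_eq_nsmul ℝ]
    exact sub_le_sub_left (le_abs_self x) _
  set t := sSup L with ht
  -- The points `t + (n + 1)⁻¹` lie outside `L` and the points `t - (n + 1)⁻¹` inside it; the limit
  -- lemma carries the resulting disjointness to `t` from both sides.
  have hpos : ((x - t • a) ⊔ 0) ⊓ a = 0 := by
    refine posPart_inf_eq_zero_of_forall_pos ha fun n => ?_
    rw [sub_sub, ← add_smul]
    by_contra hn
    have := le_csSup hbdd hn
    have hp : (0 : ℝ) < ((n : ℝ) + 1)⁻¹ := by positivity
    rw [← ht] at this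
    linarith
  have hneg : ((t • a - x) ⊔ 0) ⊓ a = 0 := by
    refine posPart_inf_eq_zero_of_forall_pos ha fun n => ?_
    have hp : (0 : ℝ) < ((n : ℝ) + 1)⁻¹ := by positivity
    obtain ⟨s, hs, hts⟩ := exists_lt_of_lt_csSup hL (show t - ((n : ℝ) + 1)⁻¹ < sSup L by linarith)
    have := (hdich (t - ((n : ℝ) + 1)⁻¹)).resolve_left (hdown _ _ hts.le hs)
    rwa [sub_smul, sub_right_comm] at this
  refine ⟨t, fun b hb => ?_⟩
  rw [Set.mem_singleton_iff.1 hb, abs_of_nonneg ha]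
  refine le_antisymm ?_ (le_inf (abs_nonneg _) ha)
  have habs : |x - t • a| ≤ ((x - t • a) ⊔ 0) + ((t • a - x) ⊔ 0) := by
    refine abs_le'.2 ⟨?_, ?_⟩
    · exact le_sup_left.trans (le_add_of_nonneg_right le_sup_right)
    · rw [neg_sub]
      exact le_sup_left.trans (le_add_of_nonneg_left le_sup_right)
  refine (inf_le_inf_right a habs).trans ((inf_add_le le_sup_right le_sup_right ha).trans ?_)
  rw [hpos, hneg, add_zero]

/-- A positive element of an atom of the band algebra cannot meet both of two disjoint
elements. -/
theorem inf_eq_zero_or_of_isAtom {A : Band E} (hA : IsAtom A) {a : E} (haA : a ∈ A) (ha : 0 ≤ a)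
    {p q : E} (hp : 0 ≤ p) (hq : 0 ≤ q) (hpq : p ⊓ q = 0) : p ⊓ a = 0 ∨ q ⊓ a = 0 := by
  by_contra! hne
  -- The part of the atom `A` disjoint from `p` contains `q ⊓ a ≠ 0`, so it is all of `A`; then `a`
  -- itself is disjoint from `p`.
  have hB : A ≤ disjointCompl ({p} : Set E) := by
    rcases hA.le_iff.1 (inf_le_left : A ⊓ disjointCompl ({p} : Set E) ≤ A) with h | h
    · exfalso
      have hmem : q ⊓ a ∈ A ⊓ disjointCompl ({p} : Set E) := by
        refine ⟨mem_of_le haA (le_inf hq ha) inf_le_right, ?_⟩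
        rintro _ rfl
        rw [abs_of_nonneg hp, abs_of_nonneg (le_inf hq ha)]
        refine le_antisymm (le_trans ?_ hpq.le) (le_inf (le_inf hq ha) hp)
        exact le_inf inf_le_right (inf_le_left.trans inf_le_left)
      rw [h] at hmem
      exact hne.2 hmem
    · exact inf_eq_left.1 h
  have := hB haA p rfl
  rw [abs_of_nonneg hp, abs_of_nonneg ha, inf_comm] at this
  exact hne.1 this

/-- An Archimedean Riesz space with finitely many atoms in an atomic band algebra is
finite-dimensional. -/
theorem finiteDimensional_of_finite_atoms [IsAtomic (Band E)]
    (hfin : {A : Band E | IsAtom A}.Finite) : FiniteDimensional ℝ E := by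
  classical
  have : Finite {A : Band E // IsAtom A} := hfin
  have := Fintype.ofFinite {A : Band E // IsAtom A}
  have hex : ∀ A : {A : Band E // IsAtom A}, ∃ a ∈ A.1, 0 ≤ a ∧ a ≠ 0 := by
    rintro ⟨A, hA⟩
    by_contra! h
    refine hA.1 (le_bot_iff.1 fun x hx => ?_)
    have := h |x| (abs_mem hx) (abs_nonneg x)
    exact eq_zero_of_disjoint_self (by rw [this, inf_idem])
  choose a haA ha ha0 using hex
  have hatom := fun A : {A : Band E // IsAtom A} =>
    exists_sub_smul_mem_disjointCompl (ha A) (ha0 A)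
      fun _ _ hp hq hpq => inf_eq_zero_or_of_isAtom A.2 (haA A) (ha A) hp hq hpq
  have hdisj : ∀ A B, A ≠ B → a B ∈ disjointCompl ({a A} : Set E) := by
    rintro A B hAB _ rfl
    have h := (B.2.disjoint_of_ne A.2 fun e => hAB (Subtype.ext e.symm)).eq_bot
    exact (le_compl_iff B.1 A.1).2 h (haA B) _ (haA A)
  -- The vectors `a A` form a maximal disjoint system: the band generated by `y ≠ 0` contains some
  -- atom, and the `a A` in it cannot be disjoint from `y`.
  have hmax : ∀ y : E, (∀ A, y ∈ disjointCompl ({a A} : Set E)) → y = 0 := by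
    intro y hy
    by_contra hy0
    have hyy := subset_disjointCompl_disjointCompl ({y} : Set E) rfl
    rcases IsAtomic.eq_bot_or_exists_atom_le
      (disjointCompl (disjointCompl ({y} : Set E) : Set E)) with h | ⟨A, hA, hle⟩
    · rw [h] at hyy
      exact hy0 hyy
    · have h1 := hle (haA ⟨A, hA⟩)
      refine ha0 ⟨A, hA⟩ (eq_zero_of_disjoint_self (h1 _ ?_))
      rintro _ rfl
      rw [inf_comm]
      exact hy ⟨A, hA⟩ _ rfl
  refine Module.finite_def.2 ⟨Finset.univ.image a, eq_top_iff.2 fun x _ => ?_⟩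
  choose t ht using fun A => hatom A x
  -- The remainder is disjoint from each `a A`: so is `x - t A • a A`, and so are the other `a B`.
  have hx : x - ∑ B, t B • a B = 0 := by
    refine hmax _ fun A => ?_
    rw [← Finset.add_sum_erase _ _ (Finset.mem_univ A), ← sub_sub]
    refine (disjointCompl ({a A} : Set E)).toSubmodule.sub_mem (ht A)
      ((disjointCompl ({a A} : Set E)).toSubmodule.sum_mem fun B hB => ?_)
    exact (disjointCompl ({a A} : Set E)).toSubmodule.smul_mem _
      (hdisj A B (Finset.ne_of_mem_erase hB).symm)
  rw [sub_eq_zero.1 hx]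
  refine Submodule.sum_mem _ fun B _ => Submodule.smul_mem _ _ (Submodule.subset_span ?_)
  simp

end Band

/-- By contraposition: without such a sequence the descending chain condition makes the band algebra
atomic, with finitely many atoms. -/
theorem exists_disjoint_sequence_band {E : Type u} [AddCommGroup E] [Lattice E] [Module ℝ E]
    [ArchimedeanRieszSpace E] (hE : ¬ FiniteDimensional ℝ E) :
    ∃ f : ℕ → Band E, (∀ n, f n ≠ ⊥) ∧ ∀ m n, m ≠ n → Disjoint (f m) (f n) := by
  by_contra h
  have := wellFoundedLT_of_no_disjoint_sequence h
  have : IsAtomic (Band E) := isAtomic_of_orderBot_wellFounded_lt wellFounded_lt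
  exact hE (Band.finiteDimensional_of_finite_atoms (finite_setOf_isAtom_of_no_disjoint_sequence h))

theorem mainTheorem5 {E : Type u} {F : Type v}
    [AddCommGroup E] [Lattice E] [Module ℝ E] [ArchimedeanRieszSpace E]
    [AddCommGroup F] [Lattice F] [Module ℝ F] [ArchimedeanRieszSpace F]
    (hE : ¬ FiniteDimensional ℝ E) (hF : ¬ FiniteDimensional ℝ F) :
    ¬ BooleanIsomorphic (FreeProduct (Band E) (Band F)) (Band (FremlinTensor E F)) ∧
      ¬ IsCompleteBooleanAlgebra (FreeProduct (Band E) (Band F)) ∧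
      IsCompleteBooleanAlgebra (Band (FremlinTensor E F)) := by
  have hinc : ¬ IsCompleteBooleanAlgebra (FreeProduct (Band E) (Band F)) :=
    FreeProduct.not_isCompleteBooleanAlgebra (exists_disjoint_sequence_band hE)
      (exists_disjoint_sequence_band hF)
  exact ⟨fun h => hinc (h.isCompleteBooleanAlgebra Band.isCompleteBooleanAlgebra), hinc,
    Band.isCompleteBooleanAlgebra⟩
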